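/- Let $R$ be a left and right Ore domain (not necessarily commutative) that is a local ring, let $Q$ be its classical quotient ring, viewed as an overring of $R$, and let $K=Q/R$, an $R$-$R$-bimodule. Call a left $R$-module $M$ \emph{Matlis-cotorsion} if $\operatorname{Ext}^1_R({}_RQ,M)=0$, and call a left $R$-module $S$ \emph{strongly flat} if $\operatorname{Ext}^1_R(S,M)=0$ for every Matlis-cotorsion left $R$-module $M$. A class $\mathcal X$ of left $R$-modules is \emph{covering} if for every left $R$-module $M$ there is a homomorphism $f\colon X\to M$ with $X\in\mathcal X$ such that every homomorphism $Y\to M$ with $Y\in\mathcal X$ factors through $f$, and every endomorphism $h$ of $X$ with $fh=f$ is an automorphism. Suppose that for every strongly flat left $R$-module $S$ the left $R$-module $K\otimes_R S$ is isomorphic to a direct sum of copies of $K$. If the class of strongly flat left $R$-modules is covering, then it is equal to the class of flat left $R$-modules; that is, a left $R$-module is strongly flat if and only if it is flat. -/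

import Mathlib

/-! Left modules over a ring `R` are objects of `ModuleCat R`, or types with `Module R`;
right modules are types with `Module Rᵐᵒᵖ`. -/

universe u

open CategoryTheory TensorProduct

noncomputable section

namespace StronglyFlat

section Tensor

/-- The `A`-submodule of `N ⊗[ℤ] M` generated by the elements `(n r) ⊗ m - n ⊗ (r m)`. -/
def balancedRelations (A : Type*) (R N M : Type*) [Ring A] [Ring R]
    [AddCommGroup N] [Module A N] [Module Rᵐᵒᵖ N] [AddCommGroup M] [Module R M] :
    Submodule A (N ⊗[ℤ] M) :=
  Submodule.span A {t | ∃ (n : N) (r : R) (m : M),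
    t = (MulOpposite.op r • n) ⊗ₜ[ℤ] m - n ⊗ₜ[ℤ] (r • m)}

/-- The relations form the additive subgroup that they generate, whatever the ring `A` of
left operators of the bimodule `N` is. -/
theorem balancedRelations_toAddSubgroup (A : Type*) (R N M : Type*) [Ring A] [Ring R]
    [AddCommGroup N] [Module A N] [Module Rᵐᵒᵖ N] [SMulCommClass A Rᵐᵒᵖ N]
    [AddCommGroup M] [Module R M] :
    (balancedRelations A R N M).toAddSubgroup =
      AddSubgroup.closure {t : N ⊗[ℤ] M | ∃ (n : N) (r : R) (m : M),
        t = (MulOpposite.op r • n) ⊗ₜ[ℤ] m - n ⊗ₜ[ℤ] (r • m)} := by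
  apply le_antisymm
  · intro x hx
    have hx' : x ∈ balancedRelations A R N M := hx
    clear hx
    unfold balancedRelations at hx'
    refine Submodule.closure_induction (p := fun y _ => y ∈ AddSubgroup.closure _)
      (AddSubgroup.zero_mem _) (fun _ _ _ _ h1 h2 => AddSubgroup.add_mem _ h1 h2) ?_ hx'
    rintro a _ ⟨n, r, m, rfl⟩
    refine AddSubgroup.subset_closure ⟨a • n, r, m, ?_⟩
    rw [smul_sub, TensorProduct.smul_tmul', TensorProduct.smul_tmul', smul_comm]
  · rw [AddSubgroup.closure_le]
    exact fun t ht => Submodule.subset_span ht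

/-- The tensor product `N ⊗_R M` of an `A`-`R`-bimodule `N` and a left `R`-module `M` over a
not necessarily commutative ring `R`, a left `A`-module. (For a mere right `R`-module `N`, take
`A = ℤ`.) -/
abbrev BalancedTensor (A : Type*) (R N M : Type*) [Ring A] [Ring R]
    [AddCommGroup N] [Module A N] [Module Rᵐᵒᵖ N] [AddCommGroup M] [Module R M] : Type _ :=
  (N ⊗[ℤ] M) ⧸ balancedRelations A R N M

/-- The map `f ⊗ M : N ⊗_R M → N' ⊗_R M` induced by a map `f : N → N'` of right modules. -/
def BalancedTensor.map {R N N' : Type*} (M : Type*) [Ring R]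
    [AddCommGroup N] [Module Rᵐᵒᵖ N] [AddCommGroup N'] [Module Rᵐᵒᵖ N']
    [AddCommGroup M] [Module R M] (f : N →ₗ[Rᵐᵒᵖ] N') :
    BalancedTensor ℤ R N M →ₗ[ℤ] BalancedTensor ℤ R N' M :=
  Submodule.mapQ _ _ (LinearMap.rTensor M f.toAddMonoidHom.toIntLinearMap) <| by
    unfold balancedRelations
    rw [Submodule.span_le]
    rintro _ ⟨n, r, m, rfl⟩
    refine Submodule.subset_span ⟨f n, r, m, ?_⟩
    simp

end Tensor

/-- The class of flat left `R`-modules: `- ⊗_R M` preserves monomorphisms of right modules. -/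
def flatModules (R : Type u) [Ring R] : ObjectProperty (ModuleCat.{u} R) := fun M =>
  ∀ (N N' : Type u) [AddCommGroup N] [Module Rᵐᵒᵖ N] [AddCommGroup N'] [Module Rᵐᵒᵖ N']
    (f : N →ₗ[Rᵐᵒᵖ] N'), Function.Injective f →
      Function.Injective (BalancedTensor.map (M : Type u) f)

/-- A class of left modules is covering if every left module `M` has a cover `f : X ⟶ M` in it:
every map to `M` from a module of the class factors through `f`, and every endomorphism `h` of
`X` with `f ∘ h = f` is an automorphism. -/
def IsCoveringClass {R : Type u} [Ring R] (P : ObjectProperty (ModuleCat.{u} R)) : Prop :=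
  ∀ M : ModuleCat.{u} R, ∃ (X : ModuleCat.{u} R) (f : X ⟶ M), P X ∧
    (∀ (Y : ModuleCat.{u} R) (g : Y ⟶ M), P Y → ∃ k : Y ⟶ X, k ≫ f = g) ∧
    ∀ h : X ⟶ X, h ≫ f = f → IsIso h

/-- The class `⊥𝒜` of all `B` with `Ext¹(B, A) = 0` for all `A` in `𝒜`. -/
def leftOrthogonal {R : Type u} [Ring R] (P : ObjectProperty (ModuleCat.{u} R)) :
    ObjectProperty (ModuleCat.{u} R) := fun B =>
  ∀ A : ModuleCat.{u} R, P A → Subsingleton (Abelian.Ext.{u} B A 1)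

section Overring

variable {R Q : Type u} [Ring R] [Ring Q] (φ : R →+* Q)

/-- The class of left `R`-modules `M` with `Ext¹(Q, M) = 0`, for an overring `φ : R → Q`. -/
def matlisCotorsion : ObjectProperty (ModuleCat.{u} R) := fun M =>
  Subsingleton (Abelian.Ext.{u} ((ModuleCat.restrictScalars φ).obj (ModuleCat.of Q Q)) M 1)

/-- The class of strongly flat left `R`-modules, relative to the overring `φ : R → Q`. -/
def stronglyFlat : ObjectProperty (ModuleCat.{u} R) :=
  leftOrthogonal (matlisCotorsion φ)

/-- `φ : R → Q` is the classical right quotient ring of the domain `R`: it is injective, makes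
the non-zero elements invertible, and every element of `Q` is a fraction `φ(a) φ(s)⁻¹`. -/
structure IsClassicalQuotientRing : Prop where
  injective : Function.Injective φ
  isUnit : ∀ s : R, s ≠ 0 → IsUnit (φ s)
  exists_fraction : ∀ q : Q, ∃ a s : R, s ≠ 0 ∧ q * φ s = φ a

/-- The `R`-`R`-bimodule `K = Q / R`. -/
def QuotientBimodule : Type u := Q ⧸ φ.range.toAddSubgroup

namespace QuotientBimodule

instance : AddCommGroup (QuotientBimodule φ) :=
  inferInstanceAs (AddCommGroup (Q ⧸ φ.range.toAddSubgroup))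

/-- The projection `Q → Q / R`. -/
def mk : Q →+ QuotientBimodule φ := QuotientAddGroup.mk' φ.range.toAddSubgroup

theorem mk_surjective : Function.Surjective (mk φ) :=
  QuotientAddGroup.mk'_surjective _

/-- Left multiplication by `r` on `Q / R`. -/
def lmul (r : R) : QuotientBimodule φ →+ QuotientBimodule φ :=
  QuotientAddGroup.map _ _ (AddMonoidHom.mulLeft (φ r)) <| by
    rintro _ ⟨x, rfl⟩
    exact ⟨r * x, map_mul φ r x⟩

/-- Right multiplication by `r` on `Q / R`. -/
def rmul (r : R) : QuotientBimodule φ →+ QuotientBimodule φ :=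
  QuotientAddGroup.map _ _ (AddMonoidHom.mulRight (φ r)) <| by
    rintro _ ⟨x, rfl⟩
    exact ⟨x * r, map_mul φ x r⟩

theorem lmul_mk (r : R) (q : Q) : lmul φ r (mk φ q) = mk φ (φ r * q) := rfl

theorem rmul_mk (r : R) (q : Q) : rmul φ r (mk φ q) = mk φ (q * φ r) := rfl

instance : Module R (QuotientBimodule φ) where
  smul r x := lmul φ r x
  one_smul x := by
    obtain ⟨q, rfl⟩ := mk_surjective φ x
    exact (lmul_mk φ 1 q).trans (by simp)
  mul_smul r s x := by
    obtain ⟨q, rfl⟩ := mk_surjective φ x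
    change lmul φ (r * s) _ = lmul φ r (lmul φ s _)
    simp only [lmul_mk, map_mul, mul_assoc]
  smul_zero r := map_zero (lmul φ r)
  smul_add r := map_add (lmul φ r)
  add_smul r s x := by
    obtain ⟨q, rfl⟩ := mk_surjective φ x
    change lmul φ (r + s) _ = lmul φ r _ + lmul φ s _
    simp only [lmul_mk, map_add, add_mul]
  zero_smul x := by
    obtain ⟨q, rfl⟩ := mk_surjective φ x
    exact (lmul_mk φ 0 q).trans (by simp)

instance : Module Rᵐᵒᵖ (QuotientBimodule φ) where
  smul r x := rmul φ r.unop x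
  one_smul x := by
    obtain ⟨q, rfl⟩ := mk_surjective φ x
    exact (rmul_mk φ 1 q).trans (by simp)
  mul_smul r s x := by
    obtain ⟨q, rfl⟩ := mk_surjective φ x
    change rmul φ (s.unop * r.unop) _ = rmul φ r.unop (rmul φ s.unop _)
    simp only [rmul_mk, map_mul, mul_assoc]
  smul_zero r := map_zero (rmul φ r.unop)
  smul_add r := map_add (rmul φ r.unop)
  add_smul r s x := by
    obtain ⟨q, rfl⟩ := mk_surjective φ x
    change rmul φ (r.unop + s.unop) _ = rmul φ r.unop _ + rmul φ s.unop _
    simp only [rmul_mk, map_add, mul_add]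
  zero_smul x := by
    obtain ⟨q, rfl⟩ := mk_surjective φ x
    exact (rmul_mk φ 0 q).trans (by simp)

theorem smul_mk (r : R) (q : Q) : r • mk φ q = mk φ (φ r * q) := rfl

theorem op_smul_mk (r : R) (q : Q) : MulOpposite.op r • mk φ q = mk φ (q * φ r) := rfl

instance : SMulCommClass R Rᵐᵒᵖ (QuotientBimodule φ) where
  smul_comm r s x := by
    obtain ⟨q, rfl⟩ := mk_surjective φ x
    change lmul φ r (rmul φ s.unop _) = rmul φ s.unop (lmul φ r _)
    simp only [lmul_mk, rmul_mk, mul_assoc]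

end QuotientBimodule

end Overring

/-- A left and right Ore domain: the non-zero elements of the domain `R` form a left Ore set
in `R` and in the opposite ring. -/
structure IsOreDomain (R : Type u) [Ring R] : Prop extends IsDomain R where
  left_ore : Nonempty (OreLocalization.OreSet (nonZeroDivisors R))
  right_ore : Nonempty (OreLocalization.OreSet (nonZeroDivisors Rᵐᵒᵖ))

end StronglyFlat

end

/-! Write `D` for `Q` as a left `R`-module. Every nonzero element of `R` acts bijectively on `D`,
and the Ore condition makes every such uniquely divisible module injective
(`UniquelyDivisible.baer`).

Strongly flat implies flat: by duality and injectivity of the character module of `D`, `Ext¹(D, X⁺)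
= 0` for every right module `X`. A strongly flat module is therefore left orthogonal to all
character modules, which forces flatness.

For the converse, let `f : S → M` be a strongly flat cover of a flat module and `C` its kernel. Then
`C` is right orthogonal to `D` (Wakamatsu) and pure in `S` (flatness of `M`). Moreover `S` is a
retract of an extension of copies of `D` by a free module (`InGeneratedClass.exists_retract`), so it
is torsion-free. Purity and the extension property for maps into `C` turn an equation `c = p (i x) +
s • p n` into `h c = s • z` with `z` in `C` and `f ∘ h = f`. The cover property makes `h` an
automorphism, so `C` is divisible. Thus `C` is uniquely divisible, hence injective and a direct
summand of `S`. A cover has no nonzero summand in its kernel, so `C = 0` and `S ≅ M`. -/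

noncomputable section

namespace StronglyFlat

/-! ### Vanishing of `Ext¹` in terms of lifting, extending and splitting. -/

section ExtVanishing

open Abelian

variable {R : Type u} [Ring R] {B A X Y D : Type u}
  [AddCommGroup A] [Module R A] [AddCommGroup B] [Module R B] [AddCommGroup X] [Module R X]
  [AddCommGroup Y] [Module R Y] [AddCommGroup D] [Module R D]

variable (R B A) in
/-- The group `Ext¹(B, A)` of left `R`-modules vanishes. -/
abbrev ExtVanishes : Prop :=
  Subsingleton (Ext.{u} (ModuleCat.of R B) (ModuleCat.of R A) 1)

/-- An exact sequence `0 → X → Y → B → 0` of modules is a short exact complex in `ModuleCat R`. -/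
theorem shortExact_moduleCat {i : X →ₗ[R] Y} {g : Y →ₗ[R] B} (hi : Function.Injective i)
    (hg : Function.Surjective g) (h : Function.Exact i g) :
    (ShortComplex.moduleCatMk i g h.linearMap_comp_eq_zero).ShortExact :=
  { exact := (ShortComplex.ShortExact.moduleCat_exact_iff_function_exact _).mpr h
    mono_f := (ModuleCat.mono_iff_injective _).mpr hi
    epi_g := (ModuleCat.epi_iff_surjective _).mpr hg }

theorem ExtVanishes.exists_extension (hE : ExtVanishes R B A) {i : X →ₗ[R] Y} {g : Y →ₗ[R] B}
    (hi : Function.Injective i) (hg : Function.Surjective g) (h : Function.Exact i g)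
    (v : X →ₗ[R] A) : ∃ w : Y →ₗ[R] A, w ∘ₗ i = v := by
  obtain ⟨x, hx⟩ := Ext.contravariant_sequence_exact₁ (shortExact_moduleCat hi hg h)
    (ModuleCat.of R A) (Ext.mk₀ (ModuleCat.ofHom v)) (add_zero 1) (hE.elim _ _)
  obtain ⟨w, rfl⟩ := (Ext.mk₀_bijective _ _).2 x
  rw [Ext.mk₀_comp_mk₀] at hx
  have := (Ext.mk₀_bijective _ _).1 hx
  exact ⟨w.hom, congrArg ModuleCat.Hom.hom this⟩

theorem ExtVanishes.exists_lift (hE : ExtVanishes R B A) {i : A →ₗ[R] Y} {g : Y →ₗ[R] D}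
    (hi : Function.Injective i) (hg : Function.Surjective g) (h : Function.Exact i g)
    (v : B →ₗ[R] D) : ∃ w : B →ₗ[R] Y, g ∘ₗ w = v := by
  obtain ⟨x, hx⟩ := Ext.covariant_sequence_exact₃ (ModuleCat.of R B) (shortExact_moduleCat hi hg h)
    (Ext.mk₀ (ModuleCat.ofHom v)) (zero_add 1) (hE.elim _ _)
  obtain ⟨w, rfl⟩ := (Ext.mk₀_bijective _ _).2 x
  rw [Ext.mk₀_comp_mk₀] at hx
  have := (Ext.mk₀_bijective _ _).1 hx
  exact ⟨w.hom, congrArg ModuleCat.Hom.hom this⟩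

variable (R A) in
/-- Every module embeds into an injective module. -/
theorem exists_injective_embedding : ∃ (E : Type u) (_ : AddCommGroup E) (_ : Module R E)
    (i : A →ₗ[R] E), Function.Injective i ∧ Module.Injective R E := by
  let E := Injective.under (ModuleCat.of R A)
  refine ⟨E, inferInstance, inferInstance, (Injective.ι (ModuleCat.of R A)).hom,
    (ModuleCat.mono_iff_injective _).mp inferInstance, ?_⟩
  rw [Module.injective_iff_injective_object]
  exact inferInstanceAs (Injective E)

/-- `Ext¹(B, A)` vanishes if every extension of `B` by `A` splits. -/
theorem extVanishes_of_split
    (hs : ∀ (Y : Type u) [AddCommGroup Y] [Module R Y] (i : A →ₗ[R] Y) (g : Y →ₗ[R] B),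
      Function.Injective i → Function.Surjective g → Function.Exact i g →
        ∃ r : Y →ₗ[R] A, r ∘ₗ i = LinearMap.id) : ExtVanishes R B A := by
  obtain ⟨E, _, _, i, hi, hE⟩ := exists_injective_embedding R A
  rw [Module.injective_iff_injective_object] at hE
  have hex : Function.Exact i i.range.mkQ := LinearMap.exact_map_mkQ_range i
  let T := ShortComplex.moduleCatMk i i.range.mkQ hex.linearMap_comp_eq_zero
  have hT : T.ShortExact := shortExact_moduleCat hi (Submodule.mkQ_surjective _) hex
  have : Injective T.X₂ := hE
  refine subsingleton_of_forall_eq 0 fun x => ?_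
  -- Since `E` is injective, `x` is the connecting image of a map `v : B → E / A`. The pullback `P`
  -- of `E → E / A` along `v` is an extension of `B` by `A`; a splitting of it lifts `v` to `E`,
  -- which kills `x`.
  obtain ⟨y, rfl⟩ := Ext.covariant_sequence_exact₁ (ModuleCat.of R B) hT x
    (Ext.eq_zero_of_injective _) (zero_add 1)
  obtain ⟨v, rfl⟩ := (Ext.mk₀_bijective _ _).2 y
  let v' : B →ₗ[R] E ⧸ i.range := v.hom
  let P : Submodule R (E × B) := LinearMap.eqLocus (i.range.mkQ ∘ₗ LinearMap.fst R E B)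
    (v' ∘ₗ LinearMap.snd R E B)
  let j : A →ₗ[R] P := LinearMap.codRestrict P (LinearMap.inl R E B ∘ₗ i) fun a => by
    change i.range.mkQ (i a) = v' 0
    rw [map_zero, hex.apply_apply_eq_zero]
  let g : P →ₗ[R] B := LinearMap.snd R E B ∘ₗ P.subtype
  have hj : Function.Injective j := fun a b hab => hi (congrArg (fun p : P => p.1.1) hab)
  have hg : Function.Surjective g := fun b => by
    obtain ⟨e, he⟩ := Submodule.mkQ_surjective _ (v' b)
    exact ⟨⟨(e, b), he⟩, rfl⟩
  have hjg : Function.Exact j g := by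
    rintro ⟨⟨e, b⟩, hp⟩
    constructor
    · rintro (rfl : b = 0)
      have : i.range.mkQ e = 0 := by
        have : i.range.mkQ e = v' 0 := hp
        rwa [map_zero] at this
      obtain ⟨a, rfl⟩ := (hex e).mp this
      exact ⟨a, rfl⟩
    · rintro ⟨a, ha⟩
      exact (congrArg (fun p : P => p.1.2) ha).symm
  obtain ⟨r, hr⟩ := hs P j g hj hg hjg
  have hsplit : ∃ r, r ∘ₗ j = LinearMap.id := ⟨r, hr⟩
  obtain ⟨s, hgs⟩ := ((hjg.split_tfae hj hg).out 0 1).mpr hsplit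
  let k : ModuleCat.of R B ⟶ T.X₂ := ModuleCat.ofHom (LinearMap.fst R E B ∘ₗ P.subtype ∘ₗ s)
  have hv : v = k ≫ T.g := by
    ext b
    have h1 : i.range.mkQ (s b).1.1 = v' (s b).1.2 := (s b).2
    have h2 : (s b).1.2 = b := LinearMap.congr_fun hgs b
    rw [h2] at h1
    exact h1.symm
  rw [hv, ← Ext.mk₀_comp_mk₀, Ext.comp_assoc_of_second_deg_zero, hT.comp_extClass]
  exact Ext.comp_zero ..

theorem ExtVanishes.of_middle {i : X →ₗ[R] Y} {g : Y →ₗ[R] D} (hi : Function.Injective i)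
    (hg : Function.Surjective g) (h : Function.Exact i g) (hX : ExtVanishes R X A)
    (hD : ExtVanishes R D A) : ExtVanishes R Y A := by
  refine subsingleton_of_forall_eq 0 fun x => ?_
  obtain ⟨y, rfl⟩ := Ext.contravariant_sequence_exact₂ (shortExact_moduleCat hi hg h)
    (ModuleCat.of R A) x (hX.elim _ _)
  rw [hD.elim y 0]
  exact Ext.comp_zero ..

theorem ExtVanishes.finsupp (hE : ExtVanishes R D A) (ι : Type u) :
    ExtVanishes R (ι →₀ D) A := by
  refine extVanishes_of_split fun Y _ _ i g hi hg h => ?_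
  choose s hs using fun l : ι => hE.exists_lift hi hg h (Finsupp.lsingle l)
  have hsplit : ∃ l, g ∘ₗ l = LinearMap.id := ⟨Finsupp.lsum ℕ s, by
    ext l d : 2
    simpa using LinearMap.congr_fun (hs l) d⟩
  exact ((h.split_tfae hi hg).out 0 1).mp hsplit

theorem extVanishes_of_projective [Module.Projective R B] : ExtVanishes R B A := by
  refine extVanishes_of_split fun Y _ _ i g hi hg h => ?_
  exact ((h.split_tfae hi hg).out 0 1).mp (Module.projective_lifting_property g LinearMap.id hg)

end ExtVanishing

/-! ### Uniquely divisible modules over Ore domains are injective. -/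

section UniquelyDivisible

variable {R : Type*} [Ring R]

variable (R) in
/-- A module on which every non-zero element of `R` acts bijectively. -/
def UniquelyDivisible (D : Type*) [AddCommGroup D] [Module R D] : Prop :=
  ∀ s : R, s ≠ 0 → Function.Bijective fun d : D => s • d

variable (R) in
/-- The left Ore condition for the non-zero elements of `R`. -/
def LeftOreCondition : Prop := ∀ a b : R, a ≠ 0 → ∃ s t : R, s ≠ 0 ∧ s * b = t * a

theorem leftOreCondition_of_oreSet [IsDomain R]
    (h : Nonempty (OreLocalization.OreSet (nonZeroDivisors R))) : LeftOreCondition R := by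
  obtain ⟨h⟩ := h
  intro a b ha
  exact ⟨_, _, nonZeroDivisors.ne_zero (h.oreDenom b ⟨a, mem_nonZeroDivisors_of_ne_zero ha⟩).2,
    h.ore_eq b ⟨a, mem_nonZeroDivisors_of_ne_zero ha⟩⟩

variable {D : Type*} [AddCommGroup D] [Module R D]

/-- Fix `a ≠ 0` in `I` and solve `a • d = g a`. For `b` in `I` the Ore relation `s * b = t * a`
gives `s • b • d = t • g a = s • g b`, and `s` cancels. -/
theorem UniquelyDivisible.baer (hD : UniquelyDivisible R D) (hR : LeftOreCondition R) :
    Module.Baer R D := by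
  intro I g
  by_cases hI : ∃ a ∈ I, a ≠ 0
  · obtain ⟨a, haI, ha⟩ := hI
    obtain ⟨d, hd⟩ := (hD a ha).2 (g ⟨a, haI⟩)
    refine ⟨LinearMap.toSpanSingleton R D d, fun b hb => ?_⟩
    obtain ⟨s, t, hs, hst⟩ := hR a b ha
    apply (hD s hs).1
    have h1 : s • (⟨b, hb⟩ : I) = t • ⟨a, haI⟩ := Subtype.ext hst
    have h2 := congrArg g h1
    rw [map_smul, map_smul, ← hd] at h2
    change s • b • d = s • g ⟨b, hb⟩
    rw [h2, smul_smul, smul_smul, hst]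
  · push Not at hI
    refine ⟨0, fun x hx => ?_⟩
    have : (⟨x, hx⟩ : I) = 0 := Subtype.ext (hI x hx)
    rw [this, map_zero, LinearMap.zero_apply]

theorem UniquelyDivisible.finsupp (hD : UniquelyDivisible R D) (ι : Type*) :
    UniquelyDivisible R (ι →₀ D) := fun s hs => by
  refine ⟨fun v w h => ?_, fun v => ?_⟩
  · ext i
    exact (hD s hs).1 (DFunLike.congr_fun h i)
  · have h0 : Function.surjInv (hD s hs).2 0 = 0 :=
      (hD s hs).1 ((Function.surjInv_eq (hD s hs).2 0).trans (smul_zero s).symm)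
    refine ⟨v.mapRange _ h0, ?_⟩
    ext i
    exact Function.surjInv_eq (hD s hs).2 (v i)

end UniquelyDivisible

/-! ### Character modules with values in `ℚ / ℤ`. -/

section Character

/-- The character group of a left `R`-module, as a right `R`-module. -/
def RightCharacter (A : Type*) [AddCommGroup A] : Type _ := A →+ AddCircle (1 : ℚ)

/-- The character group of a right `R`-module, as a left `R`-module. -/
def LeftCharacter (A : Type*) [AddCommGroup A] : Type _ := A →+ AddCircle (1 : ℚ)

variable (R A : Type*) [Ring R] [AddCommGroup A]

instance : AddCommGroup (RightCharacter A) := inferInstanceAs (AddCommGroup (A →+ _))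
instance : AddCommGroup (LeftCharacter A) := inferInstanceAs (AddCommGroup (A →+ _))
instance : FunLike (RightCharacter A) A (AddCircle (1 : ℚ)) :=
  inferInstanceAs (FunLike (A →+ _) A _)
instance : FunLike (LeftCharacter A) A (AddCircle (1 : ℚ)) :=
  inferInstanceAs (FunLike (A →+ _) A _)
instance : AddMonoidHomClass (RightCharacter A) A (AddCircle (1 : ℚ)) :=
  inferInstanceAs (AddMonoidHomClass (A →+ _) A _)
instance : AddMonoidHomClass (LeftCharacter A) A (AddCircle (1 : ℚ)) :=
  inferInstanceAs (AddMonoidHomClass (A →+ _) A _)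

instance [Module R A] : Module Rᵐᵒᵖ (RightCharacter A) where
  smul r χ := AddMonoidHom.comp χ (DistribSMul.toAddMonoidHom A r.unop)
  one_smul χ := AddMonoidHom.ext fun a => congrArg χ (one_smul R a)
  mul_smul r s χ := AddMonoidHom.ext fun a => congrArg χ (mul_smul s.unop r.unop a)
  smul_zero _ := rfl
  smul_add _ _ _ := rfl
  add_smul r s χ := AddMonoidHom.ext fun a =>
    (congrArg χ (add_smul r.unop s.unop a)).trans (map_add χ _ _)
  zero_smul χ := AddMonoidHom.ext fun a => (congrArg χ (zero_smul R a)).trans (map_zero χ)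

instance [Module Rᵐᵒᵖ A] : Module R (LeftCharacter A) where
  smul r χ := AddMonoidHom.comp χ (DistribSMul.toAddMonoidHom A (MulOpposite.op r))
  one_smul χ := AddMonoidHom.ext fun a => congrArg χ (one_smul Rᵐᵒᵖ a)
  mul_smul r s χ := AddMonoidHom.ext fun a =>
    congrArg χ (mul_smul (MulOpposite.op s) (MulOpposite.op r) a)
  smul_zero _ := rfl
  smul_add _ _ _ := rfl
  add_smul r s χ := AddMonoidHom.ext fun a =>
    (congrArg χ (add_smul (MulOpposite.op r) (MulOpposite.op s) a)).trans (map_add χ _ _)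
  zero_smul χ := AddMonoidHom.ext fun a => (congrArg χ (zero_smul Rᵐᵒᵖ a)).trans (map_zero χ)

variable {R A} {B : Type*} [AddCommGroup B]

theorem RightCharacter.smul_apply [Module R A] (r : R) (χ : RightCharacter A) (a : A) :
    (MulOpposite.op r • χ) a = χ (r • a) := rfl

theorem LeftCharacter.smul_apply [Module Rᵐᵒᵖ A] (r : R) (χ : LeftCharacter A) (a : A) :
    (r • χ) a = χ (MulOpposite.op r • a) := rfl

/-- The map of character modules induced by a map of left modules. -/
def RightCharacter.dual [Module R A] [Module R B] (f : A →ₗ[R] B) :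
    RightCharacter B →ₗ[Rᵐᵒᵖ] RightCharacter A where
  toFun χ := AddMonoidHom.comp χ f.toAddMonoidHom
  map_add' _ _ := rfl
  map_smul' r χ := AddMonoidHom.ext fun a => congrArg χ (map_smul f r.unop a).symm

/-- The map of character modules induced by a map of right modules. -/
def LeftCharacter.dual [Module Rᵐᵒᵖ A] [Module Rᵐᵒᵖ B] (f : A →ₗ[Rᵐᵒᵖ] B) :
    LeftCharacter B →ₗ[R] LeftCharacter A where
  toFun χ := AddMonoidHom.comp χ f.toAddMonoidHom
  map_add' _ _ := rfl
  map_smul' r χ := AddMonoidHom.ext fun a => congrArg χ (map_smul f (MulOpposite.op r) a).symm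

theorem addMonoidHom_dual_surjective (f : A →+ B) (hf : Function.Injective f)
    (χ : A →+ AddCircle (1 : ℚ)) : ∃ ψ : B →+ AddCircle (1 : ℚ), ψ.comp f = χ :=
  CharacterModule.dual_surjective_of_injective f.toIntLinearMap hf χ

theorem addMonoidHom_dual_exact {C : Type*} [AddCommGroup C] {f : A →+ B} {g : B →+ C}
    (hg : Function.Surjective g) (h : Function.Exact f g) (χ : B →+ AddCircle (1 : ℚ))
    (hχ : χ.comp f = 0) : ∃ ψ : C →+ AddCircle (1 : ℚ), ψ.comp g = χ := by
  have hle : g.ker ≤ χ.ker := fun b hb => by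
    obtain ⟨a, rfl⟩ := (h b).mp hb
    exact DFunLike.congr_fun hχ a
  exact ⟨g.liftOfSurjective hg ⟨χ, hle⟩, AddMonoidHom.ext fun b => by simp⟩

theorem addMonoidHom_dual_injective (g : A →+ B) (hg : Function.Surjective g)
    {χ ψ : B →+ AddCircle (1 : ℚ)} (h : χ.comp g = ψ.comp g) : χ = ψ :=
  AddMonoidHom.ext fun b => by
    obtain ⟨a, rfl⟩ := hg b
    exact DFunLike.congr_fun h a

theorem UniquelyDivisible.rightCharacter [Module R A] (hA : UniquelyDivisible R A) :
    UniquelyDivisible Rᵐᵒᵖ (RightCharacter A) := by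
  intro s hs
  have hs' := hA s.unop (MulOpposite.unop_ne_zero_iff _ |>.mpr hs)
  refine ⟨fun χ ψ h => addMonoidHom_dual_injective (DistribSMul.toAddMonoidHom A s.unop) hs'.2 h,
    fun χ => addMonoidHom_dual_surjective (DistribSMul.toAddMonoidHom A s.unop) hs'.1 χ⟩

end Character

/-! ### Universal property of the balanced tensor product. -/

section Tensor

variable {N M A : Type*} (R : Type*) [Ring R] [AddCommGroup N] [Module Rᵐᵒᵖ N] [AddCommGroup M]
  [Module R M] [AddCommGroup A]

/-- The additive map on `N ⊗_R M` given by a balanced biadditive map on `N × M`. -/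
def BalancedTensor.lift (w : N →+ M →+ A)
    (hw : ∀ n (r : R) m, w (MulOpposite.op r • n) m = w n (r • m)) :
    BalancedTensor ℤ R N M →+ A :=
  ((balancedRelations ℤ R N M).liftQ
    (TensorProduct.lift (LinearMap.mk₂ ℤ (fun n m => w n m) (fun _ _ _ => by simp)
      (fun _ _ _ => by simp) (fun _ _ _ => map_add _ _ _) fun _ _ _ => map_zsmul _ _ _)) <| by
    rw [balancedRelations, Submodule.span_le]
    rintro _ ⟨n, r, m, rfl⟩
    rw [SetLike.mem_coe, LinearMap.mem_ker, map_sub, sub_eq_zero]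
    exact hw n r m).toAddMonoidHom

end Tensor

/-! ### Character modules as test modules for flatness. -/

section Character

variable {R : Type u} [Ring R] {D : Type u} [AddCommGroup D] [Module R D]

/-- Evaluation of the characters of a right module at the elements of the module. -/
def LeftCharacter.eval (R X : Type*) [Ring R] [AddCommGroup X] [Module Rᵐᵒᵖ X] :
    X →ₗ[Rᵐᵒᵖ] RightCharacter (LeftCharacter X) where
  toFun x := AddMonoidHom.eval (N := AddCircle (1 : ℚ)) x
  map_add' x y := map_add AddMonoidHom.eval x y
  map_smul' _ _ := rfl

/-- The dual of an extension of `D` by `X⁺` begins with `D⁺`, which is uniquely divisible, hence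
injective, so the dual sequence splits. Restricting the section `X⁺⁺ → E⁺` to `X` and transposing
yields a retraction `E → X⁺`. -/
theorem UniquelyDivisible.extVanishes_leftCharacter (hD : UniquelyDivisible R D)
    (hR : LeftOreCondition Rᵐᵒᵖ) (X : Type u) [AddCommGroup X] [Module Rᵐᵒᵖ X] :
    ExtVanishes R D (LeftCharacter X) := by
  refine extVanishes_of_split fun E _ _ i g hi hg h => ?_
  have hg' : Function.Injective (RightCharacter.dual g) :=
    fun _ _ => addMonoidHom_dual_injective g.toAddMonoidHom hg
  have hi' : Function.Surjective (RightCharacter.dual i) :=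
    addMonoidHom_dual_surjective i.toAddMonoidHom hi
  have hex : Function.Exact (RightCharacter.dual g) (RightCharacter.dual i) := fun χ => by
    refine ⟨addMonoidHom_dual_exact (f := i.toAddMonoidHom) (g := g.toAddMonoidHom) hg h χ, ?_⟩
    rintro ⟨ψ, rfl⟩
    refine AddMonoidHom.ext fun x => ?_
    exact (congrArg ψ (h.apply_apply_eq_zero x)).trans (map_zero ψ)
  have hsplit : ∃ ρ, ρ ∘ₗ RightCharacter.dual g = LinearMap.id :=
    (hD.rightCharacter.baer hR).extension_property _ hg' _
  obtain ⟨s, hs⟩ := ((hex.split_tfae hg' hi').out 0 1).mpr hsplit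
  let r : E →ₗ[R] LeftCharacter X :=
    { toFun := fun e => AddMonoidHom.mk' (fun x => s (LeftCharacter.eval R X x) e) fun x y => by
        rw [map_add, map_add]; rfl
      map_add' := fun e e' => AddMonoidHom.ext fun x => map_add (s (LeftCharacter.eval R X x)) e e'
      map_smul' := fun a e => AddMonoidHom.ext fun x => by
        change s (LeftCharacter.eval R X x) (a • e) =
          s (LeftCharacter.eval R X (MulOpposite.op a • x)) e
        rw [map_smul (LeftCharacter.eval R X), map_smul s, RightCharacter.smul_apply] }
  refine ⟨r, LinearMap.ext fun ξ => AddMonoidHom.ext fun x => ?_⟩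
  exact DFunLike.congr_fun (LinearMap.congr_fun hs (LeftCharacter.eval R X x)) ξ

/-- A module `S` such that `Ext¹(S, X⁺) = 0` for the character module `X⁺` of every right module
`X` is flat. -/
theorem flatModules_of_extVanishes_leftCharacter (S : Type u) [AddCommGroup S] [Module R S]
    (hS : ∀ (X : Type u) [AddCommGroup X] [Module Rᵐᵒᵖ X], ExtVanishes R S (LeftCharacter X)) :
    flatModules R (ModuleCat.of R S) := by
  intro N N' _ _ _ _ f hf
  rw [injective_iff_map_eq_zero]
  intro t ht
  refine CharacterModule.eq_zero_of_character_apply fun χ => ?_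
  have hq : Function.Exact f f.range.mkQ := LinearMap.exact_map_mkQ_range f
  have hi : Function.Injective (LeftCharacter.dual (R := R) f.range.mkQ) :=
    fun _ _ => addMonoidHom_dual_injective f.range.mkQ.toAddMonoidHom (Submodule.mkQ_surjective _)
  have hg : Function.Surjective (LeftCharacter.dual (R := R) f) :=
    addMonoidHom_dual_surjective f.toAddMonoidHom hf
  have hex : Function.Exact (LeftCharacter.dual (R := R) f.range.mkQ) (LeftCharacter.dual f) := by
    refine fun χ => ⟨addMonoidHom_dual_exact (f := f.toAddMonoidHom)
      (g := f.range.mkQ.toAddMonoidHom) (Submodule.mkQ_surjective _) hq χ, ?_⟩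
    rintro ⟨ψ, rfl⟩
    refine AddMonoidHom.ext fun x => ?_
    exact (congrArg ψ (hq.apply_apply_eq_zero x)).trans (map_zero ψ)
  let q (n : N) (s : S) : BalancedTensor ℤ R N S := Submodule.Quotient.mk (n ⊗ₜ[ℤ] s)
  -- Hom-tensor adjunction: `χ` becomes a map `S → N⁺`. Lifting it along `N'⁺ → N⁺`, whose kernel is
  -- a character module, extends `χ` to a character `ω` of `N' ⊗ S`, so `χ t = ω 0 = 0`.
  let v : S →ₗ[R] LeftCharacter N :=
    { toFun := fun s => AddMonoidHom.mk' (fun n => χ (q n s)) fun n n' => by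
        rw [← map_add]; simp only [q, TensorProduct.add_tmul]; rfl
      map_add' := fun s s' => AddMonoidHom.ext fun n => by
        change χ (q n (s + s')) = χ (q n s) + χ (q n s')
        rw [← map_add]; simp only [q, TensorProduct.tmul_add]; rfl
      map_smul' := fun r s => AddMonoidHom.ext fun n => by
        change χ (q n (r • s)) = χ (q (MulOpposite.op r • n) s)
        refine congrArg χ (Eq.symm ?_)
        rw [Submodule.Quotient.eq]
        exact Submodule.subset_span ⟨n, r, s, rfl⟩ }
  obtain ⟨w, hw⟩ := (hS _).exists_lift hi hg hex v
  let w' : N' →+ S →+ AddCircle (1 : ℚ) :=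
    { toFun := fun n => AddMonoidHom.mk' (fun s => w s n) fun s s' => by rw [map_add]; rfl
      map_zero' := AddMonoidHom.ext fun s => map_zero (w s)
      map_add' := fun n n' => AddMonoidHom.ext fun s => map_add (w s) n n' }
  let ω := BalancedTensor.lift R w' fun n r s => by
    change w s (MulOpposite.op r • n) = w (r • s) n
    rw [map_smul w, LeftCharacter.smul_apply]
  have hχ : ∀ t, ω (BalancedTensor.map S f t) = χ t := by
    intro t
    obtain ⟨t, rfl⟩ := Submodule.mkQ_surjective _ t
    induction t using TensorProduct.induction_on with
    | zero => simp only [map_zero]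
    | tmul n s => exact DFunLike.congr_fun (LinearMap.congr_fun hw s) n
    | add x y hx hy => simp only [map_add, hx, hy]
  rw [← hχ]
  exact (congrArg ω ht).trans (map_zero ω)

end Character

/-! ### The structure of modules in the class generated by `D`. -/

section Structure

variable {R : Type u} [Ring R]

theorem exists_comp_eq_of_exact {X Y Z A : Type*} [AddCommGroup X] [Module R X] [AddCommGroup Y]
    [Module R Y] [AddCommGroup Z] [Module R Z] [AddCommGroup A] [Module R A] {i : X →ₗ[R] Y}
    {g : Y →ₗ[R] Z} (hg : Function.Surjective g) (h : Function.Exact i g) (v : Y →ₗ[R] A)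
    (hv : v ∘ₗ i = 0) : ∃ w : Z →ₗ[R] A, w ∘ₗ g = v := by
  have hle : LinearMap.ker g ≤ LinearMap.ker v := fun y hy => by
    obtain ⟨x, rfl⟩ := (h y).mp hy
    exact LinearMap.congr_fun hv x
  refine ⟨(LinearMap.ker g).liftQ v hle ∘ₗ (g.quotKerEquivOfSurjective hg).symm.toLinearMap, ?_⟩
  ext y
  have : (g.quotKerEquivOfSurjective hg).symm (g y) = Submodule.Quotient.mk y := by
    rw [LinearEquiv.symm_apply_eq]; rfl
  simp [this]

variable (R) in
/-- The module `S` is left orthogonal to all modules `A` with `Ext¹(D, A) = 0`. -/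
def InGeneratedClass (D S : Type u) [AddCommGroup D] [Module R D] [AddCommGroup S]
    [Module R S] : Prop :=
  ∀ (A : Type u) [AddCommGroup A] [Module R A], ExtVanishes R D A → ExtVanishes R S A

variable {D : Type u} [AddCommGroup D] [Module R D]

/-- A module in the class generated by a uniquely divisible module `D` is a direct summand of an
extension of a direct sum of copies of `D` by a free module. -/
theorem InGeneratedClass.exists_retract (hD : UniquelyDivisible R D) (hR : LeftOreCondition R)
    {S : Type u} [AddCommGroup S] [Module R S] (hS : InGeneratedClass R D S) :
    ∃ (N κ : Type u) (_ : AddCommGroup N) (_ : Module R N)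
      (i : (S →₀ R) →ₗ[R] N) (g : N →ₗ[R] κ →₀ D) (p : N →ₗ[R] S) (σ : S →ₗ[R] N),
      Function.Injective i ∧ Function.Surjective g ∧ Function.Exact i g ∧
        p ∘ₗ σ = LinearMap.id := by
  obtain ⟨E, _, _, i₀, hi₀, hE⟩ := exists_injective_embedding R (S →₀ R)
  let p₀ : (S →₀ R) →ₗ[R] S := Finsupp.linearCombination R id
  have hp₀ : Function.Surjective p₀ := Finsupp.linearCombination_id_surjective R S
  let A : Submodule R E := (LinearMap.ker p₀).map i₀
  obtain ⟨j, hj⟩ := exists_comp_eq_of_exact (X := LinearMap.ker p₀) hp₀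
    p₀.exact_subtype_ker_map (A.mkQ ∘ₗ i₀)
    (LinearMap.ext fun x : LinearMap.ker p₀ =>
      (Submodule.Quotient.mk_eq_zero A).mpr ⟨x, x.2, rfl⟩)
  have hj' : ∀ x, j (p₀ x) = A.mkQ (i₀ x) := LinearMap.congr_fun hj
  have hjinj : Function.Injective j := by
    rw [injective_iff_map_eq_zero]
    intro s hs
    obtain ⟨x, rfl⟩ := hp₀ s
    rw [hj'] at hs
    obtain ⟨a, ha, hax⟩ := (Submodule.Quotient.mk_eq_zero A).mp hs
    rwa [← hi₀ hax]
  let κ := D →ₗ[R] E ⧸ A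
  let ev : (κ →₀ D) →ₗ[R] E ⧸ A := Finsupp.lsum ℕ fun l : κ => l
  let d : E × (κ →₀ D) →ₗ[R] E ⧸ A := A.mkQ ∘ₗ LinearMap.fst R _ _ - ev ∘ₗ LinearMap.snd R _ _
  let N : Submodule R (E × (κ →₀ D)) := (LinearMap.range j).comap d
  let p : N →ₗ[R] S := (LinearEquiv.ofInjective j hjinj).symm.toLinearMap ∘ₗ
    LinearMap.codRestrict (LinearMap.range j) (d ∘ₗ N.subtype) fun n => n.2
  have hp : ∀ n : N, j (p n) = A.mkQ n.1.1 - ev n.1.2 := fun n =>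
    congrArg Subtype.val ((LinearEquiv.ofInjective j hjinj).apply_symm_apply
      ⟨d n.1, n.2⟩)
  let i : (S →₀ R) →ₗ[R] N := LinearMap.codRestrict N (LinearMap.inl R _ _ ∘ₗ i₀) fun x => by
    refine ⟨p₀ x, ?_⟩
    rw [hj']
    simp [d]
  have hpsurj : Function.Surjective p := fun s => by
    obtain ⟨x, rfl⟩ := hp₀ s
    refine ⟨i x, hjinj ?_⟩
    rw [hp, hj']
    change A.mkQ (i₀ x) - ev 0 = _
    rw [map_zero, sub_zero]
  let B : Submodule R N := LinearMap.ker p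
  let ιB : B →ₗ[R] N := B.subtype
  have hpex : Function.Exact ιB p := p.exact_subtype_ker_map
  let fB : B →ₗ[R] E := LinearMap.fst R _ _ ∘ₗ N.subtype ∘ₗ ιB
  let sB : B →ₗ[R] κ →₀ D := LinearMap.snd R _ _ ∘ₗ N.subtype ∘ₗ ιB
  have hB : ExtVanishes R D B := by
    refine extVanishes_of_split fun Y _ _ iB y hiB hy hex => ?_
    obtain ⟨w, hw⟩ := ((hD.finsupp κ).baer hR).extension_property (M := B) iB hiB sB
    obtain ⟨v, hv⟩ := (Module.Baer.of_injective hE).extension_property (M := B) iB hiB fB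
    -- Both coordinates of `B` extend to `Y` by injectivity, but the extensions need not agree in `E
    -- / A`. Their discrepancy factors through `D`, so it is an index `l` in `κ`; adding it in the
    -- `l`-th copy of `D` corrects `w`.
    obtain ⟨l, hl⟩ := exists_comp_eq_of_exact (X := B) hy hex (A.mkQ ∘ₗ v - ev ∘ₗ w) (by
      ext b
      have h1 : w (iB b) = b.1.1.2 := LinearMap.congr_fun hw b
      have h2 : v (iB b) = b.1.1.1 := LinearMap.congr_fun hv b
      change A.mkQ (v (iB b)) - ev (w (iB b)) = 0
      rw [h1, h2, ← hp, b.2, map_zero])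
    let w' := w + Finsupp.lsingle l ∘ₗ y
    have hw' : ∀ e, d (v e, w' e) = 0 := fun e => by
      have h1 : l (y e) = A.mkQ (v e) - ev (w e) := LinearMap.congr_fun hl e
      have h2 : ev (Finsupp.single l (y e)) = l (y e) := by simp [ev]
      change A.mkQ (v e) - ev (w e + Finsupp.single l (y e)) = 0
      rw [map_add, h2, h1]
      abel
    let r₀ : Y →ₗ[R] N := LinearMap.codRestrict N (v.prod w') fun e =>
      (LinearMap.range j).mem_comap.mpr ((hw' e).symm ▸ Submodule.zero_mem _)
    refine ⟨LinearMap.codRestrict B r₀ fun e => hjinj ?_, ?_⟩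
    · rw [hp, map_zero]
      exact hw' e
    · refine LinearMap.ext fun b =>
        Subtype.ext (Subtype.ext (Prod.ext (LinearMap.congr_fun hv b) ?_))
      change w (iB b) + Finsupp.single l (y (iB b)) = sB b
      rw [hex.apply_apply_eq_zero, Finsupp.single_zero, add_zero]
      exact LinearMap.congr_fun hw b
  have hsplit : ∃ ρ, ρ ∘ₗ ιB = LinearMap.id :=
    (hS B hB).exists_extension B.injective_subtype hpsurj hpex LinearMap.id
  obtain ⟨σ, hσ⟩ := ((hpex.split_tfae (M := B) B.injective_subtype hpsurj).out 0 1).mpr hsplit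
  refine ⟨N, κ, inferInstance, inferInstance, i, LinearMap.snd R _ _ ∘ₗ N.subtype, p, σ,
    fun x y h => hi₀ (congrArg (fun n : N => n.1.1) h), fun v => ?_, ?_, hσ⟩
  · obtain ⟨e, he⟩ := A.mkQ_surjective (ev v)
    refine ⟨⟨(e, v), (LinearMap.range j).mem_comap.mpr ?_⟩, rfl⟩
    have : d (e, v) = 0 := sub_eq_zero.mpr he
    rw [this]
    exact Submodule.zero_mem _
  · rintro ⟨⟨e, v⟩, hn⟩
    constructor
    · rintro (rfl : v = 0)
      obtain ⟨s, hs⟩ := hn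
      obtain ⟨x, rfl⟩ := hp₀ s
      have hs' : A.mkQ (i₀ x) = A.mkQ e := by
        rw [← hj', hs]
        simp [d]
      obtain ⟨a, -, hae⟩ := (Submodule.Quotient.eq A).mp hs'
      refine ⟨x - a, Subtype.ext (Prod.ext ?_ rfl)⟩
      change i₀ (x - a) = e
      rw [map_sub, hae]
      abel
    · rintro ⟨x, hx⟩
      exact (congrArg (fun n : N => n.1.2) hx).symm

end Structure

/-! ### Kernels of maps onto flat modules are pure. -/

section Purity

variable {R : Type u} [Ring R]

/-- If `f : S → M` maps onto a flat module, then the kernel of `f` is pure: a linear combination of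
elements of `S` that lies in `ker f` is the combination, with the same coefficients, of elements
of `ker f`. -/
theorem exists_sum_smul_eq_of_flat {S M : Type u} [AddCommGroup S] [Module R S] [AddCommGroup M]
    [Module R M] (hM : flatModules R (ModuleCat.of R M)) (f : S →ₗ[R] M)
    (hf : Function.Surjective f) {J : Type} [Fintype J] (r : J → R) (m : J → S)
    (h : f (∑ j, r j • m j) = 0) :
    ∃ c : J → S, (∀ j, f (c j) = 0) ∧ ∑ j, r j • c j = ∑ j, r j • m j := by
  classical
  let ψ : (J → R) →ₗ[Rᵐᵒᵖ] R :=
    { toFun := fun b => ∑ j, r j * b j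
      map_add' := fun b b' => by simp [mul_add, Finset.sum_add_distrib]
      map_smul' := fun a b => by simp [Finset.sum_mul, mul_assoc] }
  let I := LinearMap.range ψ
  let φ : (J → S) →+ S := AddMonoidHom.mk' (fun t => ∑ j, r j • t j) fun t t' => by
    simp [smul_add, Finset.sum_add_distrib]
  let F : (J → S) →+ (J → M) := AddMonoidHom.compLeft f.toAddMonoidHom J
  -- The aim is that the tuple `f (m j)` lies in `T`: then it lifts to a solution `d` of `∑ r j • d
  -- j = 0`, and `c = m - d` works.
  let T : AddSubgroup (J → M) := φ.ker.map F
  let β : (J → R) →+ M →+ (J → M) ⧸ T :=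
    { toFun := fun b => AddMonoidHom.mk'
        (fun y => QuotientAddGroup.mk (fun j => b j • y)) fun y y' => by
          rw [← QuotientAddGroup.mk_add]
          exact congrArg _ (funext fun j => smul_add _ _ _)
      map_zero' := AddMonoidHom.ext fun y => by
        change QuotientAddGroup.mk _ = (QuotientAddGroup.mk 0 : (J → M) ⧸ T)
        exact congrArg _ (funext fun j => zero_smul R y)
      map_add' := fun b b' => AddMonoidHom.ext fun y => by
        change QuotientAddGroup.mk _ = (QuotientAddGroup.mk _ + QuotientAddGroup.mk _ : (J → M) ⧸ T)
        rw [← QuotientAddGroup.mk_add]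
        exact congrArg _ (funext fun j => add_smul _ _ _) }
  -- A relation `∑ r j * b j = 0` makes `b j • z` a solution in `S`, so `β` descends to the right
  -- ideal `I` generated by the `r j` and induces `Θ : I ⊗ M → M^J / T`.
  have hβ : ψ.rangeRestrict.toAddMonoidHom.ker ≤ β.ker := fun b hb => by
    have hb' : ∑ j, r j * b j = 0 := congrArg Subtype.val hb
    refine AddMonoidHom.ext fun y => ?_
    obtain ⟨z, rfl⟩ := hf y
    refine (QuotientAddGroup.eq_zero_iff _).mpr ⟨fun j => b j • z, ?_, ?_⟩
    · change ∑ j, r j • b j • z = 0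
      simp_rw [smul_smul, ← Finset.sum_smul, hb', zero_smul]
    · exact funext fun j => map_smul f _ _
  let β' : I →+ M →+ (J → M) ⧸ T :=
    ψ.rangeRestrict.toAddMonoidHom.liftOfSurjective ψ.surjective_rangeRestrict ⟨β, hβ⟩
  have hβ' : ∀ b, β' (ψ.rangeRestrict b) = β b := fun b =>
    AddMonoidHom.liftOfRightInverse_comp_apply _ _ _ ⟨β, hβ⟩ b
  let Θ := BalancedTensor.lift R β' fun n a y => by
    obtain ⟨b, rfl⟩ := ψ.surjective_rangeRestrict n
    rw [← map_smul, hβ', hβ']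
    exact congrArg (QuotientAddGroup.mk (s := T)) (funext fun j => mul_smul _ _ _)
  let e (j : J) : I := ψ.rangeRestrict (Pi.single j 1)
  have he : ∀ j, (e j : R) = r j := fun j => by simp [e, ψ, Pi.single_apply]
  let t : I ⊗[ℤ] M := ∑ j, e j ⊗ₜ[ℤ] f (m j)
  -- Flatness enters here: in `R ⊗ M` the tensor becomes `1 ⊗ ∑ r j • f (m j) = 0`.
  have ht : (Submodule.Quotient.mk t : BalancedTensor ℤ R I M) = 0 := by
    apply hM I R I.subtype I.injective_subtype
    rw [map_zero]
    change (balancedRelations ℤ R R M).mkQ (LinearMap.rTensor M _ t) = 0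
    have h1 : ∀ j, (balancedRelations ℤ R R M).mkQ (r j ⊗ₜ f (m j)) =
        (balancedRelations ℤ R R M).mkQ (1 ⊗ₜ (r j • f (m j))) := fun j => by
      rw [Submodule.mkQ_apply, Submodule.mkQ_apply, Submodule.Quotient.eq]
      exact Submodule.subset_span ⟨1, r j, f (m j), by simp⟩
    have h2 : ∀ j, LinearMap.rTensor M I.subtype.toAddMonoidHom.toIntLinearMap (e j ⊗ₜ[ℤ] f (m j)) =
        r j ⊗ₜ f (m j) := fun j => by rw [← he]; rfl
    rw [map_sum, map_sum]
    refine (Finset.sum_congr rfl fun j _ => (congrArg _ (h2 j)).trans (h1 j)).trans ?_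
    rw [← map_sum, ← TensorProduct.tmul_sum]
    have h3 : ∑ j, r j • f (m j) = 0 := by simpa using h
    rw [h3, TensorProduct.tmul_zero, map_zero]
  have hΘ : QuotientAddGroup.mk (fun j => f (m j)) = (0 : (J → M) ⧸ T) := by
    have h1 : Θ (Submodule.Quotient.mk t) = ∑ j, β (Pi.single j 1) (f (m j)) := by
      change Θ ((balancedRelations ℤ R I M).mkQ t) = _
      rw [map_sum, map_sum]
      exact Finset.sum_congr rfl fun j _ => DFunLike.congr_fun (hβ' _) _
    rw [ht, map_zero] at h1
    rw [h1]
    change QuotientAddGroup.mk' T _ = ∑ j, QuotientAddGroup.mk' T _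
    rw [← map_sum]
    refine congrArg _ (funext fun k => ?_)
    simp [Finset.sum_apply, Pi.single_apply]
  obtain ⟨d, hd, hdm⟩ := (QuotientAddGroup.eq_zero_iff _).mp hΘ
  refine ⟨m - d, fun j => ?_, ?_⟩
  · have : f (d j) = f (m j) := congrFun hdm j
    rw [Pi.sub_apply, map_sub, this, sub_self]
  · have hd' : ∑ j, r j • d j = 0 := hd
    simp [smul_sub, Finset.sum_sub_distrib, hd']

end Purity

/-! ### Kernels of covers. -/

section Cover

variable {R : Type u} [Ring R] {D S M : Type u} [AddCommGroup D] [Module R D] [AddCommGroup S]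
  [Module R S] [AddCommGroup M] [Module R M]

/-- The map `f : S → M` is a cover of `M` by a module of the class generated by `D`. -/
structure IsGeneratedCover (D : Type u) [AddCommGroup D] [Module R D] (f : S →ₗ[R] M) : Prop where
  mem : InGeneratedClass R D S
  exists_factor : ∀ (Y : Type u) [AddCommGroup Y] [Module R Y] (g : Y →ₗ[R] M),
    InGeneratedClass R D Y → ∃ k : Y →ₗ[R] S, f ∘ₗ k = g
  bijective : ∀ h : S →ₗ[R] S, f ∘ₗ h = f → Function.Bijective h

variable {f : S →ₗ[R] M}

theorem IsGeneratedCover.exists_inverse (hf : IsGeneratedCover D f) (h : S →ₗ[R] S)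
    (hh : f ∘ₗ h = f) : ∃ h' : S →ₗ[R] S, h' ∘ₗ h = LinearMap.id ∧ f ∘ₗ h' = f := by
  let e := LinearEquiv.ofBijective h (hf.bijective h hh)
  have he : ∀ s, e (e.symm s) = s := e.apply_symm_apply
  refine ⟨e.symm.toLinearMap, LinearMap.ext e.symm_apply_apply, LinearMap.ext fun s => ?_⟩
  calc f (e.symm s) = f (h (e.symm s)) := (LinearMap.congr_fun hh _).symm
    _ = f s := congrArg f (he s)

theorem IsGeneratedCover.surjective (hf : IsGeneratedCover D f) : Function.Surjective f := by
  obtain ⟨k, hk⟩ := hf.exists_factor (M →₀ R) (Finsupp.linearCombination R id)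
    fun A _ _ _ => extVanishes_of_projective
  intro m
  obtain ⟨x, hx⟩ := Finsupp.linearCombination_id_surjective R M m
  exact ⟨k x, (LinearMap.congr_fun hk x).trans hx⟩

/-- Wakamatsu's lemma: the kernel of a cover lies in the right orthogonal class. -/
theorem IsGeneratedCover.extVanishes_ker (hf : IsGeneratedCover D f) :
    ExtVanishes R D (LinearMap.ker f) := by
  refine extVanishes_of_split fun E _ _ i g hi hg hex => ?_
  let C := LinearMap.ker f
  let ιC : C →ₗ[R] S := C.subtype
  -- The pushout of `S` and `E` over `C` is an extension of `D` by `S`, so it lies in the class. Its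
  -- map `F` to `M`, zero on `E`, factors through `f` by some `k`; undoing the automorphism `k ∘ a`
  -- of `S` makes `k ∘ b` a retraction of `E` onto `C`.
  let W : Submodule R (S × E) := LinearMap.range (ιC.prod (-i))
  let a : S →ₗ[R] (S × E) ⧸ W := W.mkQ ∘ₗ LinearMap.inl R S E
  let b : E →ₗ[R] (S × E) ⧸ W := W.mkQ ∘ₗ LinearMap.inr R S E
  have hab : ∀ c : C, b (i c) = a c := fun c => by
    refine Eq.symm ((Submodule.Quotient.eq W).mpr ⟨c, ?_⟩)
    simp [ιC]
  have hgW : W ≤ LinearMap.ker (g ∘ₗ LinearMap.snd R S E) := by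
    rintro _ ⟨c, rfl⟩
    simp [hex.apply_apply_eq_zero]
  have hfW : W ≤ LinearMap.ker (f ∘ₗ LinearMap.fst R S E) := by
    rintro _ ⟨c, rfl⟩
    exact c.2
  let γ : (S × E) ⧸ W →ₗ[R] D := W.liftQ _ hgW
  let F : (S × E) ⧸ W →ₗ[R] M := W.liftQ _ hfW
  have ha : Function.Injective a := by
    rw [injective_iff_map_eq_zero]
    intro s hs
    obtain ⟨c, hc⟩ := (Submodule.Quotient.mk_eq_zero W).mp hs
    have h1 : -i c = 0 := congrArg Prod.snd hc
    have h2 : (c : S) = s := congrArg Prod.fst hc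
    rw [neg_eq_zero, map_eq_zero_iff i hi] at h1
    rw [← h2, h1]
    rfl
  have hγ : Function.Surjective γ := fun d => by
    obtain ⟨e, rfl⟩ := hg d
    exact ⟨b e, rfl⟩
  have hP : Function.Exact a γ := fun x => by
    constructor
    · obtain ⟨⟨s, e⟩, rfl⟩ := W.mkQ_surjective x
      intro (h0 : g e = 0)
      obtain ⟨c, rfl⟩ := (hex e).mp h0
      refine ⟨s + c, ?_⟩
      rw [map_add, ← hab]
      change W.mkQ (s, 0) + W.mkQ (0, i c) = W.mkQ (s, i c)
      rw [← map_add, Prod.mk_add_mk, add_zero, zero_add]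
    · rintro ⟨s, rfl⟩
      exact map_zero g
  obtain ⟨k, hk⟩ := hf.exists_factor _ F fun A _ _ hA =>
    ExtVanishes.of_middle ha hγ hP (hf.mem A hA) hA
  obtain ⟨h', hh', hfh'⟩ := hf.exists_inverse (k ∘ₗ a) <| LinearMap.ext fun s =>
    LinearMap.congr_fun hk (a s)
  refine ⟨LinearMap.codRestrict C (h' ∘ₗ k ∘ₗ b) fun e => ?_, LinearMap.ext fun c =>
    Subtype.ext ?_⟩
  · calc f (h' (k (b e))) = f (k (b e)) := LinearMap.congr_fun hfh' _
      _ = f 0 := LinearMap.congr_fun hk (b e)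
      _ = 0 := map_zero f
  · change h' (k (b (i c))) = c
    rw [hab]
    exact LinearMap.congr_fun hh' _

/-- Over an Ore domain, a cover of a flat module by a module of the class generated by a uniquely
divisible module is an isomorphism. -/
theorem IsGeneratedCover.ker_eq_bot_of_flat [IsDomain R] (hf : IsGeneratedCover D f)
    (hD : UniquelyDivisible R D) (hR : LeftOreCondition R)
    (hM : flatModules R (ModuleCat.of R M)) : LinearMap.ker f = ⊥ := by
  obtain ⟨N, κ, _, _, i, g, p, σ, hi, hg, hex, hpσ⟩ := hf.mem.exists_retract hD hR
  have hpσ' : ∀ s, p (σ s) = s := LinearMap.congr_fun hpσ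
  let C := LinearMap.ker f
  let ιC : C →ₗ[R] S := C.subtype
  have hκ := hD.finsupp (R := R) κ
  have hdiv : ∀ s : R, s ≠ 0 → ∀ c : C, ∃ c' : C, s • c' = c := by
    intro s hs c
    obtain ⟨v, hv⟩ := (hκ s hs).2 (g (σ c))
    obtain ⟨n, rfl⟩ := hg v
    obtain ⟨x, hx⟩ := (hex (σ c - s • n)).mp (by
      rw [map_sub, map_smul, sub_eq_zero]
      exact hv.symm)
    have hx' : i x + s • n = σ c := by rw [hx, sub_add_cancel]
    let b (l : S) : S := p (i (Finsupp.single l 1))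
    have hxb : p (i x) = ∑ l : x.support, x l • b l := by
      conv_lhs => rw [← Finsupp.sum_single x]
      rw [Finsupp.sum, map_sum, map_sum, ← Finset.sum_coe_sort]
      refine Finset.sum_congr rfl fun l _ => ?_
      rw [← map_smul, ← map_smul, Finsupp.smul_single_one]
    let ε := Fintype.equivFin x.support
    -- The index `none` carries the term `s • p n`; the others carry the terms of `p (i x)`. Purity
    -- replaces all these elements of `S` by elements of `C`.
    let r : Option (Fin (Fintype.card x.support)) → R := fun o => o.elim s fun k => x (ε.symm k)
    let m : Option (Fin (Fintype.card x.support)) → S := fun o =>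
      o.elim (p n) fun k => b (ε.symm k)
    have hsum : ∑ o, r o • m o = c := by
      rw [Fintype.sum_option]
      change s • p n + ∑ k, x (ε.symm k) • b (ε.symm k) = c
      rw [Equiv.sum_comp ε.symm fun l : x.support => x l • b l, ← hxb, ← map_smul, ← map_add,
        add_comm, hx', hpσ']
    obtain ⟨c', hc', hcsum⟩ := exists_sum_smul_eq_of_flat hM f hf.surjective r m
      (by rw [hsum]; exact c.2)
    rw [hsum, Fintype.sum_option] at hcsum
    let y (o) : C := ⟨c' o, hc' o⟩
    classical
    let θ₀ : (S →₀ R) →ₗ[R] C := Finsupp.linearCombination R fun l : S =>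
      if hl : l ∈ x.support then y (some (ε ⟨l, hl⟩)) else 0
    have hθ₀ : s • y none + θ₀ x = c := by
      refine Subtype.ext (Eq.trans ?_ hcsum)
      change s • c' none + ιC (θ₀ x) = s • c' none + _
      congr 1
      rw [Finsupp.linearCombination_apply, Finsupp.sum, ← Finset.sum_coe_sort, map_sum,
        ← Equiv.sum_comp ε]
      refine Finset.sum_congr rfl fun l _ => ?_
      rw [dif_pos l.2, map_smul]
      change x l • c' _ = x (ε.symm (ε l)) • c' _
      rw [ε.symm_apply_apply]
    -- Now `c - θ (σ c) = s • (y none - θ n)`: subtracting `θ ∘ σ` from the identity makes the image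
    -- of `c` divisible by `s` in `C`, without changing `f`.
    obtain ⟨θ, hθ⟩ := (hf.extVanishes_ker.finsupp κ).exists_extension hi hg hex θ₀
    have hθ' : θ (i x) = θ₀ x := LinearMap.congr_fun hθ x
    let h : S →ₗ[R] S := LinearMap.id - ιC ∘ₗ θ ∘ₗ σ
    have hfh : f ∘ₗ h = f := LinearMap.ext fun u => by
      change f (u - (θ (σ u) : S)) = f u
      rw [map_sub, (θ (σ u)).2, sub_zero]
    obtain ⟨h', hh', hfh'⟩ := hf.exists_inverse h hfh
    let z : C := y none - θ n
    have hz : h c = s • (z : S) := by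
      have h1 : c - θ (σ c) = s • z := by
        rw [← hx', map_add, hθ', map_smul, smul_sub]
        nth_rewrite 1 [← hθ₀]
        abel
      exact congrArg Subtype.val h1
    refine ⟨⟨h' z, ?_⟩, Subtype.ext ?_⟩
    · exact (LinearMap.congr_fun hfh' z).trans z.2
    · change s • h' z = c
      rw [← map_smul, ← hz]
      exact LinearMap.congr_fun hh' _
  -- `σ` embeds `C` into `N`, an extension of a torsion-free module by a free module over a domain.
  have htf : ∀ s : R, s ≠ 0 → ∀ c : C, s • c = 0 → c = 0 := by
    intro s hs c hc
    have hc' : s • σ c = 0 := by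
      rw [← map_smul]
      exact (congrArg σ (congrArg Subtype.val hc)).trans (map_zero σ)
    have hgc : g (σ c) = 0 := (hκ s hs).1 (by
      change s • g (σ c) = s • 0
      rw [← map_smul, hc', map_zero, smul_zero])
    obtain ⟨x, hx⟩ := (hex _).mp hgc
    rw [← hx, ← map_smul, map_eq_zero_iff i hi] at hc'
    have hx0 : x = 0 := Finsupp.ext fun l =>
      (mul_eq_zero.mp (DFunLike.congr_fun hc' l)).resolve_left hs
    refine Subtype.ext ?_
    change (c : S) = 0
    rw [← hpσ' c, ← hx, hx0, map_zero, map_zero]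
  have hC : UniquelyDivisible R C := fun s hs => by
    refine ⟨fun c c' hcc => sub_eq_zero.mp (htf s hs _ ?_), hdiv s hs⟩
    rw [smul_sub, sub_eq_zero]
    exact hcc
  obtain ⟨π, hπ⟩ := (hC.baer hR).extension_property (M := C) ιC C.injective_subtype LinearMap.id
  -- This endomorphism preserves `f`, so it is injective, yet it kills `C`.
  have hbij := hf.bijective (LinearMap.id - ιC ∘ₗ π) <| LinearMap.ext fun u => by
    change f (u - (π u : S)) = f u
    rw [map_sub, (π u).2, sub_zero]
  rw [eq_bot_iff]
  intro c hc
  refine hbij.1 ?_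
  have : π c = ⟨c, hc⟩ := LinearMap.congr_fun hπ ⟨c, hc⟩
  change c - (π c : S) = 0 - (π 0 : S)
  rw [this, map_zero]
  simp

end Cover

/-! ### Flatness of the class generated by `D`, and the main theorem. -/

section Main

variable {R : Type u} [Ring R] {D : Type u} [AddCommGroup D] [Module R D]

theorem InGeneratedClass.flatModules (hD : UniquelyDivisible R D) (hR : LeftOreCondition Rᵐᵒᵖ)
    {S : Type u} [AddCommGroup S] [Module R S] (hS : InGeneratedClass R D S) :
    flatModules R (ModuleCat.of R S) :=
  flatModules_of_extVanishes_leftCharacter S fun X _ _ => hS _ (hD.extVanishes_leftCharacter hR X)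

theorem InGeneratedClass.of_linearEquiv {S M : Type u} [AddCommGroup S] [Module R S]
    [AddCommGroup M] [Module R M] (e : S ≃ₗ[R] M) (hS : InGeneratedClass R D S) :
    InGeneratedClass R D M := by
  intro A _ _ hA
  refine extVanishes_of_split fun Y _ _ i g hi hg hex => ?_
  obtain ⟨w, hw⟩ := (hS A hA).exists_lift hi hg hex e.toLinearMap
  refine ((hex.split_tfae hi hg).out 0 1).mp (⟨w ∘ₗ e.symm.toLinearMap, ?_⟩ :
    ∃ l, g ∘ₗ l = LinearMap.id)
  ext m
  simpa using LinearMap.congr_fun hw (e.symm m)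

theorem uniquelyDivisible_restrictScalars {Q : Type u} [Ring Q] (φ : R →+* Q)
    (hφ : ∀ s : R, s ≠ 0 → IsUnit (φ s)) :
    UniquelyDivisible R ((ModuleCat.restrictScalars φ).obj (ModuleCat.of Q Q)) := by
  intro s hs
  have : Function.Bijective fun q : Q => φ s * q := by
    obtain ⟨a, ha⟩ := hφ s hs
    rw [← ha]
    exact a.mulLeft_bijective
  exact this

end Main

end StronglyFlat

end

/- The proof works over every left and right Ore domain: neither locality of `R` nor the
decomposition `hK` is needed, because a strongly flat cover of a flat module is shown directly to
have a kernel that is torsion-free and divisible, hence a direct summand, hence zero. -/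
theorem mainTheorem6 {R Q : Type u} [Ring R] [Ring Q] [IsLocalRing R]
    (hR : StronglyFlat.IsOreDomain R)
    (φ : R →+* Q) (hQ : StronglyFlat.IsClassicalQuotientRing φ)
    (hK : ∀ S : ModuleCat.{u} R, StronglyFlat.stronglyFlat φ S →
      ∃ ι : Type u, Nonempty
        (StronglyFlat.BalancedTensor R R (StronglyFlat.QuotientBimodule φ) S ≃ₗ[R]
          (ι →₀ StronglyFlat.QuotientBimodule φ)))
    (hcov : StronglyFlat.IsCoveringClass (StronglyFlat.stronglyFlat φ)) :
    StronglyFlat.stronglyFlat φ = StronglyFlat.flatModules R := by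
  open StronglyFlat in
  have := hR.toIsDomain
  have hl := leftOreCondition_of_oreSet hR.left_ore
  have hr := leftOreCondition_of_oreSet hR.right_ore
  let D := (ModuleCat.restrictScalars φ).obj (ModuleCat.of Q Q)
  have hD : UniquelyDivisible R D := uniquelyDivisible_restrictScalars φ hQ.isUnit
  have hiff : ∀ S : ModuleCat.{u} R, stronglyFlat φ S ↔ InGeneratedClass R D S := fun S =>
    ⟨fun h A _ _ hA => h (ModuleCat.of R A) hA, fun h A hA => h A hA⟩
  funext M
  refine propext ⟨fun hM => ((hiff M).mp hM).flatModules hD hr, fun hM => ?_⟩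
  obtain ⟨S, f, hS, hfac, hiso⟩ := hcov M
  have hf : IsGeneratedCover D f.hom :=
    { mem := (hiff S).mp hS
      exists_factor := fun Y _ _ g hY => by
        obtain ⟨k, hk⟩ := hfac (ModuleCat.of R Y) (ModuleCat.ofHom g) ((hiff _).mpr hY)
        exact ⟨k.hom, congrArg ModuleCat.Hom.hom hk⟩
      bijective := fun h hh => by
        have := hiso (ModuleCat.ofHom h) (ModuleCat.hom_ext hh)
        exact ConcreteCategory.bijective_of_isIso (ModuleCat.ofHom h) }
  have hinj := LinearMap.ker_eq_bot.mp (hf.ker_eq_bot_of_flat hD hl hM)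
  exact (hiff M).mpr (hf.mem.of_linearEquiv (LinearEquiv.ofBijective f.hom ⟨hinj, hf.surjective⟩))
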